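/- Let $m\ge 0$, let $G$ be a group given by a presentation $\langle x_1,\ldots,x_{m+1}\mid r_1,\ldots,r_m\rangle$ with $m+1$ generators and $m$ relators (a deficiency-1 presentation), and suppose that one of the relators is $x_i x_j x_i^{-1} x_j^{-1}$ for some $i,j\in\{1,\ldots,m+1\}$. Let $\mathrm{ab}(G)$ be the free abelianisation of $G$, that is, the quotient of $G/[G,G]$ by its torsion subgroup. If the subgroup of $\mathrm{ab}(G)$ generated by the images of $x_i$ and $x_j$ has infinite index in $\mathrm{ab}(G)$, then $G$ is large: $G$ is finitely generated and has a finite-index subgroup that admits a surjective homomorphism onto a non-abelian free group. -/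

import Mathlib

universe u

/-- The free abelianisation `ab(G)` of a group `G`: the abelianisation `G / G'` modulo its
torsion subgroup. -/
abbrev FreeAbelianisation (G : Type u) [Group G] : Type u :=
  Abelianization G ⧸ CommGroup.torsion (Abelianization G)

/-- The natural homomorphism `f : G → ab(G)`. -/
def toFreeAbelianisation (G : Type u) [Group G] : G →* FreeAbelianisation G :=
  (QuotientGroup.mk' (CommGroup.torsion (Abelianization G))).comp Abelianization.of

/-- A group is large if it is finitely generated and has a finite index subgroup admitting a
homomorphism onto a non-abelian free group, i.e. onto the free group on a set with at least two
elements. (Such a set is finite, a finite index subgroup being finitely generated, so nothing is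
lost by taking it in `Type`.) -/
def IsLarge (G : Type u) [Group G] : Prop :=
  Group.FG G ∧ ∃ H : Subgroup G, H.FiniteIndex ∧
    ∃ (α : Type) (_ : Nontrivial α) (φ : H →* FreeGroup α), Function.Surjective φ

/-! Infinite index gives a nonzero `χ : G → ℤ` killing `x_i` and `x_j`; choose `l` with `χ l ≠ 0`.
Over `ℤ[T;T⁻¹]` the Fox gradient of the commutator relator vanishes, so the cocycles on the infinite
cyclic cover that are zero on the edges over `x_l` solve `m - 1` equations in `m` unknowns. A
nonzero solution is a compactly supported integral cocycle `c` (`exists_orthogonal_foxGradient`).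

Place copies of `c` far apart, the `j`-th with values in the cyclic group generated by `t ^ j * a *
t ^ (-j)`, where `t`, `a` are free generators. A relator path meets at most one copy, so its label
is still trivial (`exists_periodic_labels`). These labels are periodic up to conjugation by `t`,
hence give a homomorphism to the free group of rank two from the subgroup where `n ∣ χ`. It sends
`x_l ^ n` to `t ^ χ l` and some `[x, x_l]` to `a ^ d` with `d ≠ 0`, which do not commute. -/

/-- The action of `ℤ` on sequences by translation. -/
def translationAut (F : Type*) [Group F] : Multiplicative ℤ →* MulAut (ℤ → F) where
  toFun n :=
    { toFun := fun f k => f (k + n.toAdd)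
      invFun := fun f k => f (k - n.toAdd)
      left_inv := fun f => by ext k; simp
      right_inv := fun f => by ext k; simp
      map_mul' := fun f g => rfl }
  map_one' := by ext f k; simp
  map_mul' a b := by
    ext f k
    simp [MulAut.mul_apply, add_assoc]

@[simp] theorem translationAut_apply {F : Type*} [Group F] (n : Multiplicative ℤ) (f : ℤ → F)
    (k : ℤ) : translationAut F n f k = f (k + n.toAdd) := rfl

/-- The unrestricted wreath product of `F` with `ℤ`. -/
abbrev IntWreath (F : Type*) [Group F] : Type _ :=
  (ℤ → F) ⋊[translationAut F] Multiplicative ℤ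

/-! ### Labels of paths in the infinite cyclic cover -/

section Paths

variable {X : Type*} {F : Type*} [Group F]

/-- The displacement of a word whose letters are given the displacements `χ`. -/
def displacement (χ : X → ℤ) : FreeGroup X →* Multiplicative ℤ :=
  FreeGroup.lift fun x => Multiplicative.ofAdd (χ x)

/-- The homomorphism recording, for every starting point `k`, the product of the labels `ℓ` along
the path that a word traces on `ℤ`. -/
def pathHom (χ : X → ℤ) (ℓ : X → ℤ → F) : FreeGroup X →* IntWreath F :=
  FreeGroup.lift fun x => ⟨ℓ x, Multiplicative.ofAdd (χ x)⟩

/-- The product of the labels along the path traced by `w` from `k`. -/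
def pathLabel (χ : X → ℤ) (ℓ : X → ℤ → F) (w : FreeGroup X) (k : ℤ) : F :=
  (pathHom χ ℓ w).left k

theorem pathHom_right (χ : X → ℤ) (ℓ : X → ℤ → F) (w : FreeGroup X) :
    (pathHom χ ℓ w).right = displacement χ w := by
  have : SemidirectProduct.rightHom.comp (pathHom χ ℓ) = displacement χ := by
    ext x; simp [pathHom, displacement]
  exact DFunLike.congr_fun this w

@[simp] theorem displacement_of (χ : X → ℤ) (x : X) :
    displacement χ (FreeGroup.of x) = Multiplicative.ofAdd (χ x) := by
  simp [displacement]

@[simp] theorem pathLabel_one (χ : X → ℤ) (ℓ : X → ℤ → F) (k : ℤ) : pathLabel χ ℓ 1 k = 1 := by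
  simp [pathLabel]

@[simp] theorem pathLabel_of (χ : X → ℤ) (ℓ : X → ℤ → F) (x : X) (k : ℤ) :
    pathLabel χ ℓ (FreeGroup.of x) k = ℓ x k := by
  simp [pathLabel, pathHom]

theorem pathLabel_mul (χ : X → ℤ) (ℓ : X → ℤ → F) (u v : FreeGroup X) (k : ℤ) :
    pathLabel χ ℓ (u * v) k =
      pathLabel χ ℓ u k * pathLabel χ ℓ v (k + (displacement χ u).toAdd) := by
  simp [pathLabel, pathHom_right]

theorem pathLabel_inv (χ : X → ℤ) (ℓ : X → ℤ → F) (u : FreeGroup X) (k : ℤ) :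
    pathLabel χ ℓ u⁻¹ k = (pathLabel χ ℓ u (k - (displacement χ u).toAdd))⁻¹ := by
  have h := pathLabel_mul χ ℓ u⁻¹ u k
  rw [inv_mul_cancel, pathLabel_one, map_inv, toAdd_inv, ← sub_eq_add_neg] at h
  exact eq_inv_of_mul_eq_one_left h.symm

theorem pathLabel_comp {F' : Type*} [Group F'] (f : F →* F') (χ : X → ℤ) (ℓ : X → ℤ → F)
    (w : FreeGroup X) (k : ℤ) :
    pathLabel χ (fun x k => f (ℓ x k)) w k = f (pathLabel χ ℓ w k) := by
  induction w using FreeGroup.induction_on generalizing k with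
  | C1 => simp
  | of x => simp
  | inv_of x _ => simp [pathLabel_inv]
  | mul u v hu hv => simp [pathLabel_mul, hu, hv]

theorem pathLabel_translate (a : ℤ) (χ : X → ℤ) (ℓ : X → ℤ → F) (w : FreeGroup X) (k : ℤ) :
    pathLabel χ (fun x k => ℓ x (k + a)) w k = pathLabel χ ℓ w (k + a) := by
  induction w using FreeGroup.induction_on generalizing k with
  | C1 => simp
  | of x => simp
  | inv_of x _ => simp [pathLabel_inv, sub_add_eq_add_sub]
  | mul u v hu hv => simp [pathLabel_mul, hu, hv, add_right_comm]

/-- The label of a path depends only on the labels within a bounded distance of its start. -/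
theorem exists_pathLabel_congr (F : Type*) [Group F] (χ : X → ℤ) (w : FreeGroup X) :
    ∃ M : ℕ, ∀ (ℓ ℓ' : X → ℤ → F) (k : ℤ),
      (∀ k' : ℤ, |k' - k| ≤ M → ∀ x, ℓ x k' = ℓ' x k') →
        pathLabel χ ℓ w k = pathLabel χ ℓ' w k := by
  induction w using FreeGroup.induction_on with
  | C1 => exact ⟨0, fun _ _ _ _ => by simp⟩
  | of x => exact ⟨0, fun ℓ ℓ' k h => by simpa using h k (by simp) x⟩
  | inv_of x _ =>
    refine ⟨(χ x).natAbs, fun ℓ ℓ' k h => ?_⟩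
    have := h (k - χ x) (by simp) x
    simp [pathLabel_inv, this]
  | mul u v hu hv =>
    obtain ⟨M, hM⟩ := hu
    obtain ⟨N, hN⟩ := hv
    refine ⟨max M ((displacement χ u).toAdd.natAbs + N), fun ℓ ℓ' k h => ?_⟩
    rw [pathLabel_mul, pathLabel_mul, hM ℓ ℓ' k, hN ℓ ℓ' _]
    · intro k' hk'
      refine h k' ?_
      push_cast
      refine le_max_of_le_right ?_
      have := abs_add_le (k' - (k + (displacement χ u).toAdd)) (displacement χ u).toAdd
      rw [show k' - (k + (displacement χ u).toAdd) + (displacement χ u).toAdd = k' - k by ring]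
        at this
      linarith
    · intro k' hk'
      refine h k' (hk'.trans ?_)
      push_cast
      exact le_max_left _ _

theorem pathLabel_pow_eq_one {χ : X → ℤ} {ℓ : X → ℤ → F} {x : X} (h : ∀ k, ℓ x k = 1) (N : ℕ)
    (k : ℤ) : pathLabel χ ℓ (FreeGroup.of x ^ N) k = 1 := by
  induction N generalizing k with
  | zero => simp
  | succ N ih => rw [pow_succ, pathLabel_mul, ih, pathLabel_of, h, one_mul]

end Paths

/-! ### Fox calculus and compactly supported cocycles -/

section Fox

open LaurentPolynomial

variable {X : Type*} [DecidableEq X]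

/-- The vector of Fox derivatives of a word, with coefficients pushed to `ℤ[T;T⁻¹]`. -/
noncomputable def foxGradient (χ : X → ℤ) (w : FreeGroup X) (k : ℤ) : X → ℤ[T;T⁻¹] :=
  (pathLabel χ (F := Multiplicative (X → ℤ[T;T⁻¹]))
    (fun x k => Multiplicative.ofAdd (Pi.single x (T (-k)))) w k).toAdd

theorem foxGradient_eq (χ : X → ℤ) (w : FreeGroup X) (k : ℤ) :
    foxGradient χ w k = (T (-k) : ℤ[T;T⁻¹]) • foxGradient χ w 0 := by
  have h1 := pathLabel_translate k χ (F := Multiplicative (X → ℤ[T;T⁻¹]))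
    (fun x k => Multiplicative.ofAdd (Pi.single x (T (-k)))) w 0
  have h2 := pathLabel_comp (AddMonoidHom.toMultiplicative
    (DistribSMul.toAddMonoidHom (X → ℤ[T;T⁻¹]) (T (-k) : ℤ[T;T⁻¹]))) χ
    (fun x k => Multiplicative.ofAdd (Pi.single x (T (-k)))) w 0
  unfold foxGradient
  rw [zero_add] at h1
  rw [← h1]
  have h3 := congrArg Multiplicative.toAdd h2
  simp only [AddMonoidHom.toMultiplicative_apply_apply, toAdd_ofAdd,
    DistribSMul.toAddMonoidHom_apply] at h3
  rw [← h3]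
  congr 3
  ext x k' : 2
  rw [← Pi.single_smul, smul_eq_mul, ← T_add]
  congr 3
  ring

/-- The path never leaves `0`, so each letter cancels its inverse in the abelian label group. -/
theorem foxGradient_commutator {χ : X → ℤ} {x y : X} (hx : χ x = 0) (hy : χ y = 0) :
    foxGradient χ (FreeGroup.of x * FreeGroup.of y * (FreeGroup.of x)⁻¹ * (FreeGroup.of y)⁻¹) 0
      = 0 := by
  simp only [foxGradient, pathLabel_mul, pathLabel_inv, pathLabel_of, map_mul, map_inv,
    displacement_of, hx, hy]
  simp

/-- Labels which are the coefficients of a vector of Laurent polynomials are computed by the Fox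
derivatives. -/
theorem pathLabel_coeff [Fintype X] (χ : X → ℤ) (C : X → ℤ[T;T⁻¹]) (w : FreeGroup X) (k : ℤ) :
    pathLabel χ (fun x k => Multiplicative.ofAdd ((C x).coeff k)) w k =
      Multiplicative.ofAdd ((C ⬝ᵥ foxGradient χ w k).coeff 0) := by
  let f : (X → ℤ[T;T⁻¹]) →+ ℤ :=
    { toFun := fun v => (C ⬝ᵥ v).coeff 0
      map_zero' := by simp
      map_add' := fun u v => by simp [dotProduct_add] }
  have h := pathLabel_comp (AddMonoidHom.toMultiplicative f) χ
    (fun x k => Multiplicative.ofAdd (Pi.single x (T (-k)))) w k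
  refine Eq.trans ?_ h
  congr 1
  ext x k' : 2
  have h0 : (C x * T (-k')).coeff 0 = (C x).coeff k' := by
    rw [T, AddMonoidAlgebra.coeff_mul_single_apply]
    simp
  simp [f, dotProduct_single, h0]

/-- Dropping coordinate `l` and the vacuous relator `j₀` leaves `m` unknowns and `m - 1` equations
over a commutative ring. -/
theorem exists_orthogonal_foxGradient {m : ℕ} (χ : Fin (m + 1) → ℤ)
    (r : Fin m → FreeGroup (Fin (m + 1))) (j₀ : Fin m) (h₀ : foxGradient χ (r j₀) 0 = 0)
    (l : Fin (m + 1)) :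
    ∃ C : Fin (m + 1) → ℤ[T;T⁻¹], C ≠ 0 ∧ C l = 0 ∧ ∀ j k, C ⬝ᵥ foxGradient χ (r j) k = 0 := by
  let ext : ({x // x ≠ l} → ℤ[T;T⁻¹]) →ₗ[ℤ[T;T⁻¹]] (Fin (m + 1) → ℤ[T;T⁻¹]) :=
    { toFun := fun v x => if h : x ≠ l then v ⟨x, h⟩ else 0
      map_add' := fun u v => by ext x : 1; by_cases h : x = l <;> simp [h]
      map_smul' := fun u v => by ext x : 1; by_cases h : x = l <;> simp [h] }
  let A : ({x // x ≠ l} → ℤ[T;T⁻¹]) →ₗ[ℤ[T;T⁻¹]] ({j // j ≠ j₀} → ℤ[T;T⁻¹]) :=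
    (Matrix.mulVecLin (Matrix.of fun (j : {j // j ≠ j₀}) => foxGradient χ (r j) 0)).comp ext
  have hA : ¬ Function.Injective A := by
    intro h
    have := card_le_of_injective ℤ[T;T⁻¹] A h
    simp only [ne_eq, Fintype.card_subtype_compl, Fintype.card_fin, Fintype.card_unique] at this
    -- With truncated subtraction, `m ≤ m - 1` is absurd only for `m > 0`.
    have := j₀.pos
    omega
  rw [← LinearMap.ker_eq_bot, Submodule.eq_bot_iff] at hA
  push Not at hA
  obtain ⟨v, hv, hv0⟩ := hA
  refine ⟨ext v, fun h => hv0 ?_, by simp [ext], fun j k => ?_⟩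
  · ext x : 1
    have := congrFun h x
    simpa [ext, x.2] using this
  · rw [foxGradient_eq, dotProduct_smul]
    by_cases hj : j = j₀
    · simp [hj, h₀]
    · have := congrFun (LinearMap.mem_ker.1 hv) ⟨j, hj⟩
      rw [dotProduct_comm]
      simp only [A, LinearMap.comp_apply, Matrix.mulVecLin_apply, Matrix.mulVec] at this
      erw [this]
      simp

end Fox

/-! ### Spreading translates of a cocycle over a free group -/

section Windows

open FreeGroup (of)

/-- Map the generators to an upper and a lower unipotent matrix; comparing the top left entries of
the two products gives `e * d = 0`. -/
theorem zpow_eq_zero_of_commute {e d : ℤ}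
    (h : Commute (of true ^ e : FreeGroup Bool) (of false ^ d)) : e = 0 ∨ d = 0 := by
  let u : Matrix.SpecialLinearGroup (Fin 2) ℤ := ModularGroup.T
  let f : FreeGroup Bool →* Matrix.SpecialLinearGroup (Fin 2) ℤ :=
    FreeGroup.lift fun i => if i then u else ModularGroup.S * u * ModularGroup.S⁻¹
  have h1 := h.map f
  simp only [map_zpow, f, FreeGroup.lift_apply_of, if_true, Bool.false_eq_true, if_false, conj_zpow, u] at h1
  have h3 : ((ModularGroup.S * ModularGroup.T ^ d * ModularGroup.S⁻¹ :
      Matrix.SpecialLinearGroup (Fin 2) ℤ) : Matrix (Fin 2) (Fin 2) ℤ) = !![1, 0; -d, 1] := by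
    rw [Matrix.SpecialLinearGroup.coe_mul, Matrix.SpecialLinearGroup.coe_mul,
      ModularGroup.coe_T_zpow, Matrix.SpecialLinearGroup.coe_inv, ModularGroup.coe_S,
      Matrix.adjugate_fin_two]
    ext i j
    fin_cases i <;> fin_cases j <;> simp
  have h2 := congrArg (fun A : Matrix.SpecialLinearGroup (Fin 2) ℤ =>
    (A : Matrix (Fin 2) (Fin 2) ℤ)) h1.eq
  simp only [Matrix.SpecialLinearGroup.coe_mul _ (_ * _ * _),
    Matrix.SpecialLinearGroup.coe_mul (_ * _ * _), h3, ModularGroup.coe_T_zpow] at h2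
  simpa using congrFun (congrFun h2 0) 0

variable {X : Type*}

/-- The labels `c x (k - j * n)`, where `k` lies in the window of length `n` centred at `j * n`,
seen in the infinite cyclic subgroup generated by the conjugate of one basis element by the
`j`-th power of the other. -/
def windowLabel (n N : ℕ) (c : X → ℤ → ℤ) (x : X) (k : ℤ) : FreeGroup Bool :=
  MulAut.conj (of true ^ ((k + N) / n)) (of false ^ c x (k - (k + N) / n * n))

theorem windowLabel_add {n : ℕ} (hn : 0 < n) (N : ℕ) (c : X → ℤ → ℤ) (x : X) (k : ℤ) :
    windowLabel n N c x (k + n) = MulAut.conj (of true) (windowLabel n N c x k) := by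
  have : (k + n + N) / (n : ℤ) = (k + N) / n + 1 := by
    rw [show k + n + N = k + N + 1 * n by ring, Int.add_mul_ediv_right _ _ (by omega)]
  rw [windowLabel, windowLabel, this, zpow_add_one, ← MulAut.mul_apply, ← map_mul,
    (Commute.zpow_self (of true) _).eq]
  congr 3
  ring_nf

/-- If `k'` lies in another window than `k`, it is within `M` of a window boundary, hence further
than `S` from both centres, and both sides are trivial. -/
theorem windowLabel_eq_of_near {S M n N : ℕ} (hN : S + M < N) (hn : n = 2 * N) {c : X → ℤ → ℤ}
    (hc : ∀ x k, (S : ℤ) < |k| → c x k = 0) {k k' : ℤ} (h : |k' - k| ≤ M) (x : X) :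
    windowLabel n N c x k' =
      MulAut.conj (of true ^ ((k + N) / n)) (of false ^ c x (k' - (k + N) / n * n)) := by
  rw [windowLabel]
  have hn0 : (0 : ℤ) < n := by omega
  have h1 := Int.emod_nonneg (k + N) hn0.ne'
  have h2 := Int.emod_lt_of_pos (k + N) hn0
  have h3 := Int.emod_nonneg (k' + N) hn0.ne'
  have h4 := Int.emod_lt_of_pos (k' + N) hn0
  have h5 := Int.emod_add_mul_ediv (k + N) n
  have h6 := Int.emod_add_mul_ediv (k' + N) n
  rw [abs_le] at h
  generalize (k + N) / (n : ℤ) = j at *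
  generalize (k' + N) / (n : ℤ) = j' at *
  have h0 : (S : ℤ) + M < N := by exact_mod_cast hN
  have h8 : (n : ℤ) = 2 * N := by exact_mod_cast hn
  rcases lt_trichotomy j j' with hj | rfl | hj
  · have h7 : (n : ℤ) * (j + 1) ≤ n * j' := by gcongr; omega
    rw [hc _ _ (lt_abs.2 (Or.inr (by linarith))), hc _ _ (lt_abs.2 (Or.inl (by linarith)))]
    simp
  · rfl
  · have h7 : (n : ℤ) * (j' + 1) ≤ n * j := by gcongr; omega
    rw [hc _ _ (lt_abs.2 (Or.inl (by linarith))), hc _ _ (lt_abs.2 (Or.inr (by linarith)))]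
    simp

/-- Near `k`, the labels `windowLabel` factor through an infinite cyclic group. -/
theorem pathLabel_windowLabel {S M n N : ℕ} (hN : S + M < N) (hn : n = 2 * N) {c : X → ℤ → ℤ}
    (hc : ∀ x k, (S : ℤ) < |k| → c x k = 0) (χ : X → ℤ) (w : FreeGroup X) (k : ℤ)
    (hM : ∀ ℓ ℓ' : X → ℤ → FreeGroup Bool,
      (∀ k' : ℤ, |k' - k| ≤ M → ∀ x, ℓ x k' = ℓ' x k') →
        pathLabel χ ℓ w k = pathLabel χ ℓ' w k) :
    pathLabel χ (windowLabel n N c) w k = MulAut.conj (of true ^ ((k + N) / n))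
      (of false ^ (pathLabel χ (fun x k => Multiplicative.ofAdd (c x k)) w
        (k - (k + N) / n * n)).toAdd) := by
  set j := (k + N) / (n : ℤ) with hj
  have h1 := pathLabel_comp ((MulAut.conj (of true ^ j : FreeGroup Bool)).toMonoidHom.comp
    (zpowersHom (FreeGroup Bool) (of false))) χ
    (fun x k => Multiplicative.ofAdd (c x (k + (-(j * n))))) w k
  rw [pathLabel_translate (-(j * n)) χ (fun x k => Multiplicative.ofAdd (c x k))] at h1
  rw [hM _ _ fun k' hk' x => windowLabel_eq_of_near hN hn hc hk' x]
  exact h1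

/-- Otherwise a nonzero value would propagate in steps of `e` out of the support. The bound on `k`
serves to keep it in the central window. -/
theorem exists_ne_add_of_bounded {c : ℤ → ℤ} {S : ℕ} (hS : ∀ k, (S : ℤ) < |k| → c k = 0)
    (hc : ∃ k, c k ≠ 0) {e : ℤ} (he : e ≠ 0) : ∃ k, |k| ≤ S + |e| ∧ c k ≠ c (k + e) := by
  by_contra! h
  obtain ⟨k, hk⟩ := hc
  have hbd : ∀ k, c k ≠ 0 → |k| ≤ S := fun k hk => by
    by_contra! h'
    exact hk (hS k h')
  have key : ∀ i : ℕ, c (k + i * e) ≠ 0 := by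
    intro i
    induction i with
    | zero => simpa using hk
    | succ i ih =>
      have := h (k + i * e) ((hbd _ ih).trans (by simp))
      push_cast
      rwa [add_one_mul, ← add_assoc, ← this]
  have h1 := hbd _ (key (2 * S + 1))
  have h2 := hbd k hk
  have h3 := abs_sub_abs_le_abs_sub (((2 * S + 1 : ℕ) : ℤ) * e) (-k)
  rw [abs_mul, abs_neg, sub_neg_eq_add, add_comm _ k, Nat.abs_cast] at h3
  have h4 := Int.one_le_abs he
  push_cast at *
  nlinarith

/-- A compactly supported integral cocycle on the infinite cyclic cover, vanishing on the edges
over a generator of nonzero displacement, gives rise to periodic labels in the free group of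
rank two. -/
theorem exists_periodic_labels {ι : Type*} [Finite ι] (χ : X → ℤ) {l : X}
    (hl : χ l ≠ 0) (r : ι → FreeGroup X) (hr : ∀ j, displacement χ (r j) = 1) {c : X → ℤ → ℤ}
    {S : ℕ} (hS : ∀ x k, (S : ℤ) < |k| → c x k = 0) (hcl : ∀ k, c l k = 0)
    (hc : ∃ x k, c x k ≠ 0)
    (hcr : ∀ j k, pathLabel χ (fun x k => Multiplicative.ofAdd (c x k)) (r j) k = 1) :
    ∃ (n : ℕ) (ℓ : X → ℤ → FreeGroup Bool), 0 < n ∧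
      (∀ x k, ℓ x (k + n) = MulAut.conj (of true) (ℓ x k)) ∧
      (∀ j, pathHom χ ℓ (r j) = 1) ∧ (∀ k, ℓ l k = 1) ∧
      ∃ x k, ∃ d : ℤ, d ≠ 0 ∧
        pathLabel χ ℓ (of x * of l * (of x)⁻¹ * (of l)⁻¹) k = of false ^ d := by
  have := Fintype.ofFinite ι
  obtain ⟨x, hx⟩ := hc
  obtain ⟨k, hk, hck⟩ := exists_ne_add_of_bounded (hS x) hx hl
  choose M hM using fun j => exists_pathLabel_congr (FreeGroup Bool) χ (r j)
  obtain ⟨M', hM'⟩ := exists_pathLabel_congr (FreeGroup Bool) χ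
    (of x * of l * (of x)⁻¹ * (of l)⁻¹)
  -- The margin exceeds the reach of every relator and of the test commutator; the term `|χ l|` puts
  -- `k` in window `0`.
  let N := S + (∑ j, M j + M' + (χ l).natAbs) + 1
  have hN : S + (∑ j, M j + M' + (χ l).natAbs) < N := Nat.lt_succ_self _
  refine ⟨2 * N, windowLabel (2 * N) N c, by omega, windowLabel_add (by omega) N c, fun j => ?_,
    fun k => by simp [windowLabel, hcl], x, k, c x k - c x (k + χ l), sub_ne_zero.2 hck, ?_⟩
  · refine SemidirectProduct.ext ?_ ?_
    · ext1 k
      refine (pathLabel_windowLabel hN rfl hS χ (r j) k fun ℓ ℓ' h => hM j ℓ ℓ' k fun k' hk' =>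
        h k' (hk'.trans ?_)).trans ?_
      · have := Finset.single_le_sum (f := M) (fun _ _ => Nat.zero_le _) (Finset.mem_univ j)
        omega
      · simp [hcr]
    · rw [pathHom_right, hr]
      rfl
  · have hj : (k + N) / ((2 * N : ℕ) : ℤ) = 0 := by
      rw [abs_le, Int.abs_eq_natAbs] at hk
      apply Int.ediv_eq_zero_of_lt <;> omega
    rw [pathLabel_windowLabel hN rfl hS χ _ k fun ℓ ℓ' h => hM' ℓ ℓ' k fun k' hk' =>
        h k' (hk'.trans (by omega)), hj]
    simp only [pathLabel_mul, pathLabel_inv, pathLabel_of, map_mul, map_inv, displacement_of, hcl]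
    simp [sub_eq_add_neg, show k + (χ x + χ l) + -χ x = k + χ l by ring]

end Windows

/-! ### From periodic labels to largeness -/

section Large

open FreeGroup (of)

/-- A homomorphism from a finite index subgroup to a free group with non-abelian image witnesses
largeness. -/
theorem isLarge_of_not_commute {G : Type*} [Group G] [Group.FG G] (H : Subgroup G) [H.FiniteIndex]
    {F : Type} [Group F] [IsFreeGroup F] (φ : H →* F) (g h : H) (hgh : ¬ Commute (φ g) (φ h)) :
    IsLarge G := by
  -- Nielsen–Schreier: the image is free, so it remains to rule out rank at most one.
  let e := IsFreeGroup.mulEquiv φ.range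
  refine ⟨inferInstance, H, inferInstance, IsFreeGroup.Generators φ.range, ?_,
    e.symm.toMonoidHom.comp φ.rangeRestrict,
    e.symm.surjective.comp φ.rangeRestrict_surjective⟩
  by_contra hα
  rw [not_nontrivial_iff_subsingleton] at hα
  have hcomm : ∀ u v : FreeGroup (IsFreeGroup.Generators φ.range), Commute u v := by
    rcases isEmpty_or_nonempty (IsFreeGroup.Generators φ.range) with h' | ⟨⟨a⟩⟩
    · intro u v
      exact Subsingleton.elim _ _
    · intro u v
      have hz : ∀ u : FreeGroup (IsFreeGroup.Generators φ.range),
          u ∈ Subgroup.zpowers (of a) := by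
        intro u
        induction u using FreeGroup.induction_on with
        | C1 => exact one_mem _
        | of x => exact Subsingleton.elim a x ▸ Subgroup.mem_zpowers _
        | inv_of x h => exact inv_mem h
        | mul u v hu hv => exact mul_mem hu hv
      obtain ⟨p, rfl⟩ := hz u
      obtain ⟨q, rfl⟩ := hz v
      exact Commute.zpow_zpow_self _ _ _
  have h1 := (hcomm (e.symm (φ.rangeRestrict g)) (e.symm (φ.rangeRestrict h))).map e
  simp only [MulEquiv.apply_symm_apply] at h1
  exact hgh (h1.map φ.range.subtype)

theorem pathLabel_add_mul {X : Type*} {F : Type*} [Group F] {χ : X → ℤ} {ℓ : X → ℤ → F} {n : ℕ}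
    {s : F} (hℓ : ∀ x k, ℓ x (k + n) = MulAut.conj s (ℓ x k)) (w : FreeGroup X) (k z : ℤ) :
    pathLabel χ ℓ w (k + z * n) = s ^ z * pathLabel χ ℓ w k * s ^ (-z) := by
  have h1 : ∀ k, pathLabel χ ℓ w (k + n) = s * pathLabel χ ℓ w k * s⁻¹ := by
    intro k
    rw [← pathLabel_translate, ← MulAut.conj_apply, ← MulEquiv.coe_toMonoidHom, ← pathLabel_comp]
    simp [hℓ]
  induction z using Int.induction_on with
  | zero => simp
  | succ z ih =>
    rw [add_one_mul, ← add_assoc, h1, ih]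
    group
  | pred z ih =>
    have h2 := h1 (k + (-z - 1) * n)
    rw [show k + (-(z : ℤ) - 1) * n + n = k + -z * n by ring, ih] at h2
    rw [eq_mul_inv_iff_mul_eq, ← inv_mul_eq_iff_eq_mul] at h2
    rw [← h2]
    group

/-- Periodic labels on the infinite cyclic cover, compatible with the relations of `G`, define a
homomorphism on a finite index subgroup. -/
theorem isLarge_of_periodic_labels {G : Type*} [Group G] [Group.FG G] {X : Type*}
    (π : FreeGroup X →* G) (hπ : Function.Surjective π) (χ : X → ℤ) (ℓ : X → ℤ → FreeGroup Bool)
    (Ψ : G →* IntWreath (FreeGroup Bool)) (hΨ : ∀ w, Ψ (π w) = pathHom χ ℓ w) {n : ℕ} (hn : 0 < n)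
    (hℓ : ∀ x k, ℓ x (k + n) = MulAut.conj (of true) (ℓ x k)) {l : X} (hl : χ l ≠ 0)
    (hl1 : ∀ k, ℓ l k = 1) {x : X} {k d : ℤ} (hd : d ≠ 0)
    (hx : pathLabel χ ℓ (of x * of l * (of x)⁻¹ * (of l)⁻¹) k = of false ^ d) : IsLarge G := by
  have : NeZero n := ⟨hn.ne'⟩
  let q : G →* Multiplicative (ZMod n) :=
    (AddMonoidHom.toMultiplicative (Int.castAddHom (ZMod n))).comp
      (SemidirectProduct.rightHom.comp Ψ)
  have hq : ∀ g, g ∈ q.ker ↔ (n : ℤ) ∣ (Ψ g).right.toAdd := by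
    intro g
    rw [← ZMod.intCast_zmod_eq_zero_iff_dvd]
    rfl
  have hΨ_left : ∀ g a z, (Ψ g).left (a + z * n) =
      of true ^ z * (Ψ g).left a * of true ^ (-z) := by
    intro g a z
    obtain ⟨w, rfl⟩ := hπ g
    rw [hΨ]
    exact pathLabel_add_mul hℓ w a z
  let φ : q.ker →* FreeGroup Bool :=
    -- The power of `t` absorbs the conjugation produced when the base point moves by a multiple of
    -- `n`.
    MonoidHom.mk' (fun g => (Ψ g).left k * of true ^ ((Ψ g).right.toAdd / n)) fun g h => by
      obtain ⟨z, hz⟩ := (hq g).1 g.2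
      obtain ⟨z', hz'⟩ := (hq h).1 h.2
      have hn' : (n : ℤ) ≠ 0 := by omega
      simp only [Subgroup.coe_mul, _root_.map_mul, SemidirectProduct.mul_left,
        SemidirectProduct.mul_right, Pi.mul_apply, translationAut_apply, toAdd_mul, hz, hz',
        ← mul_add, Int.mul_ediv_cancel_left _ hn']
      rw [mul_comm (n : ℤ) z, hΨ_left]
      group
  have hg : π (of l ^ n) ∈ q.ker := by
    rw [hq, hΨ, pathHom_right]
    simp
  have hh : π (of x * of l * (of x)⁻¹ * (of l)⁻¹) ∈ q.ker := by
    rw [hq, hΨ, pathHom_right]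
    simp
  refine isLarge_of_not_commute q.ker φ ⟨_, hg⟩ ⟨_, hh⟩ fun hcomm => ?_
  have h1 : φ ⟨_, hg⟩ = of true ^ χ l := by
    have : (pathHom χ ℓ (of l ^ n)).left k = 1 := pathLabel_pow_eq_one hl1 n k
    simp only [φ, MonoidHom.mk'_apply, hΨ, this, pathHom_right]
    simp [hn.ne']
  have h2 : φ ⟨_, hh⟩ = of false ^ d := by
    have : (pathHom χ ℓ (of x * of l * (of x)⁻¹ * (of l)⁻¹)).left k = _ := hx
    simp only [φ, MonoidHom.mk'_apply, hΨ, this, pathHom_right]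
    simp
  rw [h1, h2] at hcomm
  exact (zpow_eq_zero_of_commute hcomm).elim hl hd

end Large

/-! ### The character `χ` and the conclusion -/

/-- A finitely generated abelian group has a nonzero homomorphism to `ℤ` vanishing on a given
subgroup of infinite index. -/
theorem exists_hom_int_of_not_finiteIndex {A : Type*} [CommGroup A] [Group.FG A] (K : Subgroup A)
    (hK : ¬ K.FiniteIndex) : ∃ f : A →* Multiplicative ℤ, f ≠ 1 ∧ ∀ a ∈ K, f a = 1 := by
  let B := Additive (A ⧸ K)
  have : Module.Finite ℤ B := Module.Finite.iff_addGroup_fg.2 inferInstance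
  have hB : ¬ Module.IsTorsion ℤ B := by
    intro h
    have := Module.finite_of_fg_torsion B h
    have : Finite (A ⧸ K) := this
    exact hK Subgroup.finiteIndex_of_finite_quotient
  obtain ⟨b, hb⟩ := not_forall.1 hB
  have hb' : (Submodule.torsion ℤ B).mkQ b ≠ 0 := fun h => by
    obtain ⟨z, hz⟩ := (Submodule.mem_torsion_iff b).1 ((Submodule.Quotient.mk_eq_zero _).1 h)
    exact hb ⟨z, hz⟩
  -- Modulo torsion `B` is free of finite rank, so its dual separates points.
  obtain ⟨f, hf⟩ := not_forall.1 ((Module.forall_dual_apply_eq_zero_iff ℤ _).not.2 hb')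
  let g : B →+ ℤ := (f.comp (Submodule.mkQ _)).toAddMonoidHom
  refine ⟨(AddMonoidHom.toMultiplicativeRight g).comp (QuotientGroup.mk' K), fun h => hf ?_,
    fun a ha => ?_⟩
  · obtain ⟨a, ha⟩ := QuotientGroup.mk'_surjective K b.toMul
    have := congrArg Multiplicative.toAdd (DFunLike.congr_fun h a)
    rw [MonoidHom.comp_apply, ha] at this
    exact this
  · rw [MonoidHom.comp_apply, QuotientGroup.mk'_apply, (QuotientGroup.eq_one_iff a).2 ha, map_one]

theorem theorem3p2 {G : Type u} [Group G] (m : ℕ) (r : Fin m → FreeGroup (Fin (m + 1)))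
    (e : PresentedGroup (Set.range r) ≃* G) (i j : Fin (m + 1))
    (hrel : ∃ k : Fin m, r k = FreeGroup.of i * FreeGroup.of j *
      (FreeGroup.of i)⁻¹ * (FreeGroup.of j)⁻¹)
    (hindex : ¬ (Subgroup.closure
      {toFreeAbelianisation G (e (PresentedGroup.of i)),
        toFreeAbelianisation G (e (PresentedGroup.of j))}).FiniteIndex) :
    IsLarge G := by
  let π : FreeGroup (Fin (m + 1)) →* G := e.toMonoidHom.comp (PresentedGroup.mk (Set.range r))
  have hπ : Function.Surjective π := e.surjective.comp (PresentedGroup.mk_surjective _)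
  have hπr : ∀ k, π (r k) = 1 := fun k => by
    change e (PresentedGroup.mk (Set.range r) (r k)) = 1
    rw [PresentedGroup.one_of_mem (Set.mem_range_self k), map_one]
  have hG : Group.FG G := Group.fg_of_surjective hπ
  have hA : Function.Surjective (toFreeAbelianisation G) :=
    (QuotientGroup.mk'_surjective _).comp QuotientGroup.mk_surjective
  have : Group.FG (FreeAbelianisation G) := Group.fg_of_surjective hA
  obtain ⟨f, hf, hfK⟩ := exists_hom_int_of_not_finiteIndex _ hindex
  let p : FreeGroup (Fin (m + 1)) →* Multiplicative ℤ := f.comp ((toFreeAbelianisation G).comp π)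
  let χ : Fin (m + 1) → ℤ := fun x => (p (FreeGroup.of x)).toAdd
  have hp : displacement χ = p := by
    ext1 x
    rw [displacement_of]
    rfl
  have hi : χ i = 0 := congrArg Multiplicative.toAdd
    (hfK _ (Subgroup.subset_closure (Set.mem_insert _ _)))
  have hj : χ j = 0 := congrArg Multiplicative.toAdd
    (hfK _ (Subgroup.subset_closure (Set.mem_insert_of_mem _ rfl)))
  obtain ⟨l, hl⟩ : ∃ l, χ l ≠ 0 := by
    by_contra! h
    have hp1 : p = 1 := by
      ext x
      exact h x
    refine hf (MonoidHom.ext fun a => ?_)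
    obtain ⟨w, rfl⟩ := (hA.comp hπ) a
    exact DFunLike.congr_fun hp1 w
  obtain ⟨k₀, hk₀⟩ := hrel
  obtain ⟨C, hC, hCl, hCr⟩ := exists_orthogonal_foxGradient χ r k₀
    (hk₀ ▸ foxGradient_commutator hi hj) l
  let c : Fin (m + 1) → ℤ → ℤ := fun x k => (C x).coeff k
  obtain ⟨S, hS⟩ : ∃ S : ℕ, ∀ x k, (S : ℤ) < |k| → c x k = 0 := by
    refine ⟨∑ x, ∑ k ∈ (C x).coeff.support, k.natAbs, fun x k hk => ?_⟩
    by_contra h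
    have h1 := Finset.single_le_sum (f := fun x => ∑ k ∈ (C x).coeff.support, k.natAbs)
      (fun _ _ => Nat.zero_le _) (Finset.mem_univ x)
    have h2 := Finset.single_le_sum (f := fun k : ℤ => k.natAbs)
      (fun _ _ => Nat.zero_le _) (Finsupp.mem_support_iff.2 h)
    rw [Int.abs_eq_natAbs] at hk
    omega
  have hc : ∃ x k, c x k ≠ 0 := by
    by_contra! h
    exact hC (funext fun x => LaurentPolynomial.ext fun k => h x k)
  have hcr : ∀ j k, pathLabel χ (fun x k => Multiplicative.ofAdd (c x k)) (r j) k = 1 := by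
    intro j k
    rw [pathLabel_coeff, hCr]
    simp
  have hr : ∀ k, displacement χ (r k) = 1 := fun k => by
    simp only [hp, p, MonoidHom.comp_apply, hπr, map_one]
  obtain ⟨n, ℓ, hn, hper, hrel, hl1, x, k, d, hd, hx⟩ := exists_periodic_labels χ hl r hr hS
    (fun k => by simp [c, hCl]) hc hcr
  let Ψ : G →* IntWreath (FreeGroup Bool) :=
    (PresentedGroup.toGroup (rels := Set.range r) (f := fun x => pathHom χ ℓ (FreeGroup.of x))
      (by
        rintro _ ⟨k, rfl⟩
        rw [← hrel k]
        exact DFunLike.congr_fun (FreeGroup.ext_hom _ _ fun x => FreeGroup.lift_apply_of)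
          (r k))).comp
      e.symm.toMonoidHom
  have hΨ : ∀ w, Ψ (π w) = pathHom χ ℓ w := by
    have : Ψ.comp π = pathHom χ ℓ := by
      ext1 x
      simp only [MonoidHom.comp_apply, Ψ, π, MulEquiv.coe_toMonoidHom, MulEquiv.symm_apply_apply]
      exact PresentedGroup.toGroup.of _
    exact DFunLike.congr_fun this
  exact isLarge_of_periodic_labels π hπ χ ℓ Ψ hΨ hn hper hl hl1 hd hx
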